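/- All graphs are finite and simple. A vertex cut of a graph $G$ is a set $S\subseteq V(G)$ such that $G-S$ is disconnected. The connectivity $\kappa(G)$ is $|V(G)|-1$ if $G$ is complete and the minimum size of a vertex cut of $G$ otherwise; $G$ is $2$-connected if $\kappa(G)\ge 2$. A bipartite graph is chordal bipartite if every cycle of length at least six has a chord, that is, an edge of the graph that is not an edge of the cycle but joins two vertices of the cycle. For $p,q\ge 1$ let $L(p,q)$ be the Cartesian product of a path on $p$ vertices and a path on $q$ vertices. Theorem. Let $n\ge 4$. Every $2$-connected chordal bipartite graph with $n$ vertices and $m$ edges satisfies $$m\ \ge\ \begin{cases}\dfrac{3n-3}{2} & \text{if } n \text{ is odd},\\[2mm] \dfrac{3n}{2}-2 & \text{if } n\text{ is even}.\end{cases}$$ Both bounds are tight: for every $n\ge 4$ there is a $2$-connected chordal bipartite graph with $n$ vertices for which equality holds. For even $n$, the ladder $L(2,n/2)$ is such a graph. For odd $n$, such a graph is obtained from the disjoint union of $K_{2,3}$ and the ladder $L(2,(n-3)/2)$ by identifying an edge of $K_{2,3}$ with the first rung of the ladder, i.e. with the edge joining the first vertices of its two paths on $(n-3)/2$ vertices.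 -/

import Mathlib

namespace SimpleGraph

/-- A set `S` of vertices is a vertex cut of `G` if the graph `G - S` is disconnected, i.e. has two
vertices which are not joined by a path of `G - S` (so the graph without vertices does not count as
disconnected). -/
def IsVertexCut {V : Type*} (G : SimpleGraph V) (S : Finset V) : Prop :=
  ¬ (G.induce {v | v ∉ S}).Preconnected

open Classical in
/-- The (vertex) connectivity `κ(G)` of a finite graph: `|V(G)| - 1` if `G` is complete, and
otherwise the minimum size of a vertex cut of `G`. A graph that is not complete has a vertex cut
(all vertices but two nonadjacent ones), so the infimum is then attained. -/
noncomputable def vertexConnectivity {V : Type*} (G : SimpleGraph V) : ℕ :=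
  if G = ⊤ then Nat.card V - 1 else sInf {k | ∃ S : Finset V, G.IsVertexCut S ∧ S.card = k}

/-- `G` is `k`-connected if `κ(G) ≥ k`. -/
def IsVertexKConnected {V : Type*} (G : SimpleGraph V) (k : ℕ) : Prop :=
  k ≤ G.vertexConnectivity

/-- A graph is chordal bipartite if it is bipartite and every cycle of length at least six has a
chord. -/
def IsChordalBipartite {V : Type*} (G : SimpleGraph V) : Prop :=
  G.IsBipartite ∧ ∀ (v : V) (c : G.Walk v v), c.IsCycle → 6 ≤ c.length → ∃ e, c.IsChord e

/-- The grid graph `L(p, q)`: the Cartesian product of the paths on `p` and on `q` vertices. -/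
def gridGraph (p q : ℕ) : SimpleGraph (Fin p × Fin q) :=
  pathGraph p □ pathGraph q

/-- The graph obtained from the disjoint union of `G` and `H` by identifying the edge `ab` of `G`
with the edge `cd` of `H`, where `c` is identified with `a` and `d` with `b`. The vertices are
those of `G` together with the vertices of `H` other than `c` and `d`. -/
def glueEdge {V W : Type*} (G : SimpleGraph V) (H : SimpleGraph W) {a b : V} {c d : W}
    (_hab : G.Adj a b) (_hcd : H.Adj c d) : SimpleGraph (V ⊕ {w : W // w ≠ c ∧ w ≠ d}) where
  Adj
    | .inl v, .inl v' => G.Adj v v'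
    | .inr w, .inr w' => H.Adj w w'
    | .inl v, .inr w => (v = a ∧ H.Adj c w) ∨ (v = b ∧ H.Adj d w)
    | .inr w, .inl v => (v = a ∧ H.Adj c w) ∨ (v = b ∧ H.Adj d w)
  symm := ⟨by
    rintro (v | w) (v' | w') h
    · exact G.adj_symm h
    · exact h
    · exact h
    · exact H.adj_symm h⟩
  loopless := ⟨by
    rintro (v | w) h
    · exact G.irrefl h
    · exact H.irrefl h⟩

/-- The two vertices of the first rung of the ladder `L(2, k)` are adjacent. -/
theorem gridGraph_two_adj_first_rung (k : ℕ) (hk : 0 < k) :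
    (gridGraph 2 k).Adj (0, ⟨0, hk⟩) (1, ⟨0, hk⟩) := by
  simp [gridGraph, boxProd_adj, pathGraph_adj]

/-- In `K_{2,3}` every vertex of the first side is adjacent to every vertex of the second side. -/
theorem completeBipartiteGraph_two_three_adj (i : Fin 2) (j : Fin 3) :
    (completeBipartiteGraph (Fin 2) (Fin 3)).Adj (.inl i) (.inr j) := by
  simp

/-- The ladder `L(2, k)`, `k ≥ 1`, with a copy of `K_{2,3}` glued along its first rung: an edge of
`K_{2,3}` is identified with the edge `(0,0)(1,0)` of the ladder. (Up to isomorphism, the choice of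
the edge of `K_{2,3}` and of its direction is immaterial.) -/
def ladderGlueK23 (k : ℕ) (hk : 0 < k) :=
  glueEdge (gridGraph 2 k) (completeBipartiteGraph (Fin 2) (Fin 3))
    (gridGraph_two_adj_first_rung k hk) (completeBipartiteGraph_two_three_adj 0 0)

end SimpleGraph

namespace SimpleGraph

variable {V : Type*} {G : SimpleGraph V}

/-! Lower bound: grow an edge set `F`, covered by a vertex set `S`, from one edge by adding
four-cycles that meet `F` in an edge. One new vertex brings at least two new edges and two bring at
least three, so `3|S| ≤ 2|F| + 4` persists (`exists_fourCycleClosed`). A maximal `F` is closed under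
four-cycles. If `va`, `vb` are edges and a path avoiding `v` joins `a` to `b`, chords break the
resulting cycle into four-cycles, so `va ∈ F` forces `vb ∈ F` (`IsChordalBipartite.mem_of_walk`). By
2-connectedness such paths always exist, so `F` reaches every vertex and `3n ≤ 2m + 4`; parity
sharpens this for odd `n`.

Sharpness: for both families it suffices to bound the edge number from above, as the lower bound
gives the rest. An `st`-numbering shows 2-connectedness, and building the graph by attaching
four-cycles along edges shows that it is chordal bipartite (`isChordalBipartite_of_rank`). -/

/-! ### Walks, chords and four-cycles -/

theorem Walk.exists_of_induce {s : Set V} {a b : s} (p : (G.induce s).Walk a b) :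
    ∃ q : G.Walk a b, ∀ z ∈ q.support, z ∈ s := by
  induction p with
  | @nil u => exact ⟨.nil, by simp⟩
  | @cons u _ _ h _ ih =>
    obtain ⟨q, hq⟩ := ih
    exact ⟨.cons (induce_adj.mp h) q, by simpa using hq⟩

/-- Replacing the part of a walk between two of its vertices by an edge outside the walk shortens
the walk. -/
theorem Walk.exists_shorter_of_chord {a b x y : V} (p : G.Walk a b) (hx : x ∈ p.support)
    (hy : y ∈ p.support) (hxy : G.Adj x y) (he : s(x, y) ∉ p.edges) :
    ∃ q : G.Walk a b, q.length < p.length ∧ q.support ⊆ p.support := by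
  classical
  have shortcut : ∀ {x y : V} (q : G.Walk a x) (r : G.Walk x y) (t : G.Walk y b), G.Adj x y →
      s(x, y) ∉ r.edges → ∃ w : G.Walk a b, w.length < (q.append (r.append t)).length ∧
        w.support ⊆ (q.append (r.append t)).support := by
    intro x y q r t hxy he
    refine ⟨q.append (Walk.cons hxy t), ?_, ?_⟩
    · have : 2 ≤ r.length := by
        match r with
        | .nil => exact absurd rfl hxy.ne
        | .cons h .nil => simp at he
        | .cons h (.cons h' r') => simp
      simp only [Walk.length_append, Walk.length_cons]
      omega
    · intro z hz
      simp only [Walk.mem_support_append_iff, Walk.support_cons, List.mem_cons] at hz ⊢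
      rcases hz with h | rfl | h
      · exact Or.inl h
      · exact Or.inl q.end_mem_support
      · exact Or.inr (Or.inr h)
  obtain ⟨q, r, rfl⟩ := Walk.mem_support_iff_exists_append.mp hx
  rcases Walk.mem_support_append_iff _ _ |>.mp hy with h | h
  · obtain ⟨q₁, q₂, rfl⟩ := Walk.mem_support_iff_exists_append.mp h
    rw [← Walk.append_assoc]
    refine shortcut q₁ q₂ r hxy.symm ?_
    rw [Sym2.eq_swap]
    intro h
    simp [h] at he
  · obtain ⟨r₁, r₂, rfl⟩ := Walk.mem_support_iff_exists_append.mp h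
    refine shortcut q r₁ r₂ hxy ?_
    intro h
    simp [h] at he

/-- A set of edges is closed under four-cycles if it contains, with an edge of a four-cycle, the
other three edges. -/
def FourCycleClosed (G : SimpleGraph V) (F : Set (Sym2 V)) : Prop :=
  ∀ ⦃a b c d : V⦄, G.Adj a b → G.Adj b c → G.Adj c d → G.Adj d a → a ≠ c → b ≠ d →
    s(a, b) ∈ F → s(d, a) ∈ F

/-- In a chordal bipartite graph, the edges from `v` to the ends of a walk that avoids `v` belong to
the same sets of edges closed under four-cycles. -/
theorem IsChordalBipartite.mem_of_walk (hG : G.IsChordalBipartite) {F : Set (Sym2 V)}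
    (hF : G.FourCycleClosed F) {v : V} (n : ℕ) : ∀ {a b : V} (p : G.Walk a b), p.length = n →
      v ∉ p.support → G.Adj v a → G.Adj v b → s(v, a) ∈ F → s(v, b) ∈ F := by
  classical
  induction n using Nat.strong_induction_on with
  | _ n ih =>
  intro a b p hn hv ha hb hFa
  by_cases hp : p.IsPath
  swap
  · have hlt : p.bypass.length < p.length := by
      by_contra hcon
      exact hp (p.bypass_eq_self_of_length_le_length_bypass (not_lt.mp hcon) ▸ p.bypass_isPath)
    exact ih _ (hn ▸ hlt) p.bypass rfl (fun h => hv (p.support_bypass_subset_support h)) ha hb hFa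
  by_cases hab : a = b
  · exact hab ▸ hFa
  have hne : ∀ w ∈ p.support, w ≠ v := fun w hw h => hv (h ▸ hw)
  let c : G.Walk v v := Walk.cons ha (p.concat hb.symm)
  have hlen : c.length = p.length + 2 := by simp [c]
  have heven : Even c.length := two_colorable_iff_forall_loop_even.mp hG.1 v c
  have hedges : c.edges = s(v, a) :: (p.edges ++ [s(b, v)]) := by
    simp [c, Walk.edges_concat]
  have hc : c.IsCycle := by
    rw [Walk.cons_isCycle_iff]
    refine ⟨hp.concat hv hb.symm, ?_⟩
    rw [Walk.edges_concat]
    simp only [List.concat_eq_append, List.mem_append, List.mem_singleton, not_or]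
    refine ⟨fun h => hv (Walk.fst_mem_support_of_mem_edges _ h), ?_⟩
    simp [hab, hb.ne]
  by_cases h6 : 6 ≤ c.length
  · obtain ⟨e, he⟩ := hG.2 v c hc h6
    induction e with
    | _ x y =>
    obtain ⟨hxy, hne', hx, hy⟩ := Walk.isChord_sym2Mk.mp he
    have hsupp : ∀ z, z ∈ c.support → z = v ∨ z ∈ p.support := by
      intro z hz
      simp only [c, Walk.support_cons, Walk.support_concat, List.mem_cons,
        List.mem_append, List.not_mem_nil, or_false] at hz
      tauto
    -- A chord `vz` splits `p` at `z` into two shorter walks; induction passes from `va` to `vz` and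
    -- then to `vb`.
    have spoke : ∀ z ∈ p.support, G.Adj v z → s(v, z) ∉ c.edges → s(v, b) ∈ F := by
      intro z hz hvz hnz
      rw [hedges] at hnz
      simp only [List.mem_cons, List.mem_append, List.not_mem_nil, or_false, not_or] at hnz
      have hza : z ≠ a := fun h => hnz.1 (by rw [h])
      have hzb : z ≠ b := fun h => hnz.2.2 (by rw [h, Sym2.eq_swap])
      obtain ⟨q, r, rfl⟩ := Walk.mem_support_iff_exists_append.mp hz
      have hq : q.length ≠ 0 := fun h => hza (Walk.eq_of_length_eq_zero h).symm
      have hr : r.length ≠ 0 := fun h => hzb (Walk.eq_of_length_eq_zero h)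
      rw [Walk.length_append] at hn
      rw [Walk.mem_support_append_iff, not_or] at hv
      exact ih r.length (by omega) r rfl hv.2 hvz hb
        (ih q.length (by omega) q rfl hv.1 ha hvz hFa)
    rcases hsupp x hx with rfl | hxp
    · rcases hsupp y hy with rfl | hyp
      · exact absurd rfl hxy.ne
      · exact spoke y hyp hxy hne'
    · rcases hsupp y hy with rfl | hyp
      · exact spoke x hxp hxy.symm (by rwa [Sym2.eq_swap])
      · obtain ⟨q, hq, hqs⟩ := p.exists_shorter_of_chord hxp hyp hxy (by
          intro h; apply hne'; rw [hedges]; simp [h])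
        exact ih _ (hn ▸ hq) q rfl (fun h => hv (hqs h)) ha hb hFa
  -- An even cycle of length below six is a four-cycle, so only `p` of length two survives.
  · match p with
    | .nil => exact absurd rfl hab
    | .cons h .nil =>
      rw [hlen] at heven
      exact absurd heven (by simp; decide)
    | .cons (v := x) h (.cons h' .nil) =>
      rw [Sym2.eq_swap]
      refine hF ha h h' hb.symm ?_ hab hFa
      exact (hne x (by simp)).symm
    | .cons h (.cons h' (.cons h'' .nil)) =>
      rw [hlen] at heven
      exact absurd heven (by simp; decide)
    | .cons h (.cons h' (.cons h'' (.cons h''' p'))) =>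
      exact absurd (by rw [hlen]; simp) h6

/-! ### Growing an edge set by four-cycles -/

/-- Starting from an edge and adding four-cycles that meet the current set in an edge, one reaches
a set of edges closed under four-cycles with many edges compared to the vertices it covers. -/
theorem exists_fourCycleClosed [Finite V] {u v : V} (huv : G.Adj u v) :
    ∃ (F : Finset (Sym2 V)) (S : Finset V), s(u, v) ∈ F ∧ (F : Set (Sym2 V)) ⊆ G.edgeSet ∧
      (∀ e ∈ F, ∀ w ∈ e, w ∈ S) ∧ 3 * S.card ≤ 2 * F.card + 4 ∧
      G.FourCycleClosed (F : Set (Sym2 V)) := by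
  classical
  have := Fintype.ofFinite V
  let P : Finset (Sym2 V) × Finset V → Prop := fun Q =>
    s(u, v) ∈ Q.1 ∧ (Q.1 : Set (Sym2 V)) ⊆ G.edgeSet ∧ (∀ e ∈ Q.1, ∀ w ∈ e, w ∈ Q.2) ∧
      3 * Q.2.card ≤ 2 * Q.1.card + 4
  have h0 : P ({s(u, v)}, {u, v}) := by
    refine ⟨by simp, by simpa using huv, by simp, ?_⟩
    have := Finset.card_le_two (a := u) (b := v)
    simp only [Finset.card_singleton]
    omega
  obtain ⟨⟨F, S⟩, ⟨hmem, hsub, hinc, hcard⟩, hmax⟩ :=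
    Set.exists_max_image {Q | P Q} (fun Q => Q.1.card) (Set.toFinite _) ⟨_, h0⟩
  refine ⟨F, S, hmem, hsub, hinc, hcard, ?_⟩
  -- By maximality of `F`, an enlargement that respects the inequality adds no edge.
  have grow : ∀ (E : Finset (Sym2 V)) (T : Finset V), (E : Set (Sym2 V)) ⊆ G.edgeSet →
      (∀ e ∈ E, ∀ w ∈ e, w ∈ S ∪ T) → 3 * (S ∪ T).card ≤ 2 * (F ∪ E).card + 4 →
      E ⊆ F := by
    intro E T hE hT hc
    have h := hmax (F ∪ E, S ∪ T) ⟨by simp [hmem], by simp [hsub, hE], ?_, hc⟩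
    · have : F = F ∪ E := Finset.eq_of_subset_of_card_le Finset.subset_union_left h
      rw [this]; exact Finset.subset_union_right
    · intro e he w hw
      rcases Finset.mem_union.mp he with he | he
      · exact Finset.mem_union_left _ (hinc e he w hw)
      · exact hT e he w hw
  have hnot : ∀ x y, (x ∉ S ∨ y ∉ S) → s(x, y) ∉ F := by
    rintro x y h hF
    rcases h with h | h
    · exact h (hinc _ hF x (by simp))
    · exact h (hinc _ hF y (by simp))
  replace hcard : 3 * S.card ≤ 2 * F.card + 4 := hcard
  intro a b c d hab hbc hcd hda hac hbd hF
  have ha : a ∈ S := hinc _ hF a (by simp)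
  have hb : b ∈ S := hinc _ hF b (by simp)
  have e1 : s(b, c) ≠ s(c, d) := by simp [hbd, hbc.ne]
  have e2 : s(b, c) ≠ s(d, a) := by simp [hbd, hac.symm, hab.ne']
  have e3 : s(c, d) ≠ s(d, a) := by simp [hac.symm, hcd.ne]
  have hE : (({s(b, c), s(c, d), s(d, a)} : Finset (Sym2 V)) : Set (Sym2 V)) ⊆ G.edgeSet := by
    intro e he
    simp only [Finset.coe_insert, Finset.coe_singleton, Set.mem_insert_iff,
      Set.mem_singleton_iff] at he
    rcases he with rfl | rfl | rfl <;> assumption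
  have hT : ∀ e ∈ ({s(b, c), s(c, d), s(d, a)} : Finset (Sym2 V)), ∀ w ∈ e,
      w ∈ S ∪ {c, d} := by
    intro e he w hw
    simp only [Finset.mem_insert, Finset.mem_singleton] at he
    rcases he with rfl | rfl | rfl <;>
      (rw [Sym2.mem_iff] at hw; rcases hw with rfl | rfl <;> simp [ha, hb])
  refine (grow {s(b, c), s(c, d), s(d, a)} {c, d} hE hT ?_) (by simp)
  have disj : ∀ E : Finset (Sym2 V), (∀ e ∈ E, e ∉ F) →
      E ⊆ {s(b, c), s(c, d), s(d, a)} →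
      F.card + E.card ≤ (F ∪ {s(b, c), s(c, d), s(d, a)}).card := by
    intro E h1 h2
    rw [← Finset.card_union_of_disjoint (Finset.disjoint_right.mpr h1)]
    exact Finset.card_le_card (Finset.union_subset_union_right h2)
  -- Edges at a vertex outside `S` are new. One new vertex costs 3 and gains at least 2·2; two cost
  -- 6 and gain 2·3.
  by_cases hc : c ∈ S <;> by_cases hd : d ∈ S
  · have : S ∪ {c, d} = S := by
      apply Finset.union_eq_left.mpr; intro z; simp; rintro (rfl | rfl) <;> assumption
    have h := disj ∅ (by simp) (by simp)
    rw [this]; simp only [Finset.card_empty] at h; omega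
  · have h1 : S ∪ {c, d} ⊆ insert d S := by
      intro z; simp only [Finset.mem_union, Finset.mem_insert, Finset.mem_singleton]
      rintro (h | rfl | rfl) <;> simp [*]
    have h2 := (Finset.card_le_card h1).trans (Finset.card_insert_le d S)
    have h := disj {s(c, d), s(d, a)} (by
      intro e he; simp only [Finset.mem_insert, Finset.mem_singleton] at he
      rcases he with rfl | rfl <;> exact hnot _ _ (by simp [hd])) (by simp)
    rw [Finset.card_pair e3] at h
    omega
  · have h1 : S ∪ {c, d} ⊆ insert c S := by
      intro z; simp only [Finset.mem_union, Finset.mem_insert, Finset.mem_singleton]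
      rintro (h | rfl | rfl) <;> simp [*]
    have h2 := (Finset.card_le_card h1).trans (Finset.card_insert_le c S)
    have h := disj {s(b, c), s(c, d)} (by
      intro e he; simp only [Finset.mem_insert, Finset.mem_singleton] at he
      rcases he with rfl | rfl <;> exact hnot _ _ (by simp [hc]))
      (by intro e; simp; tauto)
    rw [Finset.card_pair e1] at h
    omega
  · have h2 := (Finset.card_union_le S {c, d}).trans
      (Nat.add_le_add_left Finset.card_le_two _)
    have h := disj {s(b, c), s(c, d), s(d, a)} (by
      intro e he; simp only [Finset.mem_insert, Finset.mem_singleton] at he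
      rcases he with rfl | rfl | rfl <;> exact hnot _ _ (by simp [hc, hd])) (by simp)
    rw [Finset.card_eq_three.mpr ⟨_, _, _, e1, e2, e3, rfl⟩] at h
    omega

/-! ### Connectivity and vertex cuts -/

theorem IsVertexKConnected.not_isVertexCut {k : ℕ} (hG : G.IsVertexKConnected k) {S : Finset V}
    (hS : S.card < k) : ¬ G.IsVertexCut S := by
  intro hcut
  rw [IsVertexKConnected, vertexConnectivity] at hG
  split_ifs at hG with h
  · subst h
    refine hcut fun x y => ?_
    by_cases hxy : x = y
    · exact hxy ▸ Reachable.refl _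
    · exact Adj.reachable (fun h => hxy (Subtype.ext h))
  · exact absurd (hG.trans (Nat.sInf_le ⟨S, hcut, rfl⟩)) (by omega)

theorem IsVertexKConnected.preconnected_induce {k : ℕ} (hG : G.IsVertexKConnected k) {S : Finset V}
    (hS : S.card < k) : (G.induce {v | v ∉ S}).Preconnected :=
  not_not.mp (hG.not_isVertexCut hS)

theorem Reachable.exists_adj_of_ne {u v : V} (h : G.Reachable u v) (hne : u ≠ v) :
    ∃ w, G.Adj u w := by
  obtain ⟨p⟩ := h
  cases p with
  | nil => exact absurd rfl hne
  | cons h _ => exact ⟨_, h⟩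

/-- A graph that is not complete has a vertex cut. -/
theorem exists_isVertexCut [Finite V] (hG : G ≠ ⊤) : ∃ S, G.IsVertexCut S := by
  classical
  have := Fintype.ofFinite V
  obtain ⟨u, v, huv, h⟩ := ne_top_iff_exists_not_adj.mp hG
  refine ⟨Finset.univ \ {u, v}, fun hcon => ?_⟩
  have hmem : ∀ x, x ∈ {w | w ∉ Finset.univ \ {u, v}} ↔ x = u ∨ x = v := by
    intro x; simp only [Set.mem_ofPred_eq, Finset.mem_sdiff, Finset.mem_univ, true_and,
      Finset.mem_insert, Finset.mem_singleton, not_not]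
  obtain ⟨⟨w, hw⟩, huw⟩ := (hcon ⟨u, (hmem u).mpr (Or.inl rfl)⟩
    ⟨v, (hmem v).mpr (Or.inr rfl)⟩).exists_adj_of_ne (fun h => huv (congrArg Subtype.val h))
  replace huw : G.Adj u w := huw
  rcases (hmem w).mp hw with rfl | rfl
  · exact huw.ne rfl
  · exact h huw

/-- The size condition serves complete graphs, where `κ = |V| - 1`. Otherwise a cut must be
exhibited, since `sInf ∅ = 0`. -/
theorem isVertexKConnected_of_forall_not_isVertexCut [Finite V] {k : ℕ} (hk : k + 1 ≤ Nat.card V)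
    (h : ∀ S : Finset V, S.card < k → ¬ G.IsVertexCut S) : G.IsVertexKConnected k := by
  rw [IsVertexKConnected, vertexConnectivity]
  split_ifs with htop
  · omega
  · obtain ⟨S, hS⟩ := exists_isVertexCut htop
    refine le_csInf ⟨_, S, hS, rfl⟩ ?_
    rintro _ ⟨T, hT, rfl⟩
    exact not_lt.mp fun hlt => h T hlt hT

/-! ### The lower bound -/

/-- A `2`-connected chordal bipartite graph on `n ≥ 2` vertices has at least `(3n - 4) / 2` edges. -/
theorem IsChordalBipartite.three_mul_card_le [Finite V] (hG : G.IsChordalBipartite)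
    (h2 : G.IsVertexKConnected 2) (hV : 2 ≤ Nat.card V) :
    3 * Nat.card V ≤ 2 * G.edgeSet.ncard + 4 := by
  classical
  have := Fintype.ofFinite V
  have hpre : G.Preconnected := by
    have h := h2.preconnected_induce (S := ∅) (by simp)
    intro x y
    exact (h ⟨x, by simp⟩ ⟨y, by simp⟩).map (Embedding.induce _).toHom
  have : Nontrivial V := by
    rw [← Fintype.one_lt_card_iff_nontrivial, ← Nat.card_eq_fintype_card]; omega
  obtain ⟨u⟩ : Nonempty V := inferInstance
  obtain ⟨v, huv⟩ : ∃ v, G.Adj u v := by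
    obtain ⟨w, hw⟩ := exists_ne u
    exact (hpre u w).exists_adj_of_ne hw.symm
  obtain ⟨F, S, hmem, hsub, hinc, hcard, hF⟩ := exists_fourCycleClosed huv
  have star : ∀ x a b, G.Adj x a → G.Adj x b → s(x, a) ∈ F → s(x, b) ∈ F := by
    intro x a b ha hb hFa
    have h := h2.preconnected_induce (S := {x}) (by simp)
    obtain ⟨p⟩ := h ⟨a, by simpa using ha.ne'⟩ ⟨b, by simpa using hb.ne'⟩
    obtain ⟨q, hq⟩ := p.exists_of_induce
    exact hG.mem_of_walk hF _ q rfl (fun h => hq x h (by simp)) ha hb hFa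
  -- By `star`, one edge of `F` at a vertex brings in all edges there, so `F` spreads along walks.
  have all : ∀ {x y : V}, G.Walk x y → (∃ a, G.Adj x a ∧ s(x, a) ∈ F) →
      ∃ a, G.Adj y a ∧ s(y, a) ∈ F := by
    intro x y p
    induction p with
    | nil => exact id
    | cons h _ ih =>
      rintro ⟨a, ha, haF⟩
      exact ih ⟨_, h.symm, Sym2.eq_swap ▸ star _ _ _ ha h haF⟩
  have hS : S = Finset.univ := by
    refine Finset.eq_univ_iff_forall.mpr fun x => ?_
    obtain ⟨p⟩ := hpre u x
    obtain ⟨a, -, ha⟩ := all p ⟨v, huv, hmem⟩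
    exact hinc _ ha x (by simp)
  rw [hS, Finset.card_univ, ← Nat.card_eq_fintype_card] at hcard
  have : F.card ≤ G.edgeSet.ncard := by
    rw [← Set.ncard_coe_finset]; exact Set.ncard_le_ncard hsub (Set.toFinite _)
  omega

/-! ### Invariance under isomorphism -/

variable {W : Type*} {H : SimpleGraph W}

theorem IsVertexKConnected.of_iso [Finite V] (e : G ≃g H) {k : ℕ} (hk : k + 1 ≤ Nat.card V)
    (hG : G.IsVertexKConnected k) : H.IsVertexKConnected k := by
  classical
  have : Finite W := Finite.of_equiv V e.toEquiv
  refine isVertexKConnected_of_forall_not_isVertexCut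
    (by rwa [← Nat.card_congr e.toEquiv]) fun S hS hcut => hcut ?_
  have h := hG.preconnected_induce (S := S.map e.symm.toEquiv.toEmbedding) (by simpa using hS)
  refine (Iso.preconnected_iff (e.induce ?_)).mp h
  refine ⟨fun v hv => ?_, e.injective.injOn, fun w hw => ⟨e.symm w, ?_, by simp⟩⟩
  · intro hv'
    exact hv (Finset.mem_map.mpr ⟨e v, hv', e.symm_apply_apply v⟩)
  · intro hw'
    obtain ⟨z, hz, hzw⟩ := Finset.mem_map.mp hw'
    exact hw (e.symm.injective hzw ▸ hz)

theorem IsChordalBipartite.of_iso (e : G ≃g H) (hG : G.IsChordalBipartite) :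
    H.IsChordalBipartite := by
  refine ⟨hG.1.of_hom e.symm.toHom, fun v c hc hlen => ?_⟩
  obtain ⟨p, hp⟩ := hG.2 _ (c.map e.symm.toHom) (hc.map e.symm.injective) (by simpa using hlen)
  induction p with
  | _ x y =>
  obtain ⟨hxy, hne, hx, hy⟩ := Walk.isChord_sym2Mk.mp hp
  have hsupp : ∀ z, z ∈ (c.map e.symm.toHom).support → e z ∈ c.support := by
    intro z hz
    rw [Walk.support_map, List.mem_map] at hz
    obtain ⟨w, hw, rfl⟩ := hz
    exact (e.apply_symm_apply w).symm ▸ hw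
  refine ⟨s(e x, e y), Walk.isChord_sym2Mk.mpr
    ⟨e.map_adj_iff.mpr hxy, fun h => hne ?_, hsupp x hx, hsupp y hy⟩⟩
  rw [Walk.edges_map, List.mem_map]
  refine ⟨_, h, ?_⟩
  rw [Sym2.map_mk]
  exact congrArg₂ (fun a b => s(a, b)) (e.symm_apply_apply x) (e.symm_apply_apply y)

theorem ncard_edgeSet_congr (e : G ≃g H) : G.edgeSet.ncard = H.edgeSet.ncard := by
  rw [← Nat.card_coe_set_eq, ← Nat.card_coe_set_eq]
  exact Nat.card_congr e.mapEdgeSet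

/-! ### Criteria for 2-connected and chordal bipartite graphs -/

/-- A graph with an `st`-numbering (not necessarily injective) is `2`-connected. -/
theorem isVertexKConnected_two_of_numbering [Finite V] (hV : 3 ≤ Nat.card V) (f : V → ℕ) {s t : V}
    (hst : G.Adj s t) (hlow : ∀ v ≠ s, ∃ u, G.Adj v u ∧ f u < f v)
    (hhigh : ∀ v ≠ t, ∃ u, G.Adj v u ∧ f v < f u) : G.IsVertexKConnected 2 := by
  refine isVertexKConnected_of_forall_not_isVertexCut hV fun S hS hcut => hcut ?_
  obtain ⟨m, hm⟩ : ∃ m, ∀ u ∈ S, f u = m := by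
    have : Nonempty V := ⟨s⟩
    rcases Finset.card_le_one_iff_subset_singleton (s := S) |>.mp (by omega) with ⟨v, hv⟩
    exact ⟨f v, fun u hu => by rw [Finset.mem_singleton.mp (hv hu)]⟩
  let T : Set V := {v | v ∉ S}
  obtain ⟨N, hN⟩ : ∃ N, ∀ v, f v ≤ N := by
    obtain ⟨N, hN⟩ := (Set.finite_range f).bddAbove
    exact ⟨N, fun v => hN ⟨v, rfl⟩⟩
  -- A descent from level at most `m` is strictly below `m` after its first step, so it misses `S`
  -- and ends at `s`. Dually, `up` ends at `t`, and the edge `st` joins the two kinds.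
  have down : ∀ n, ∀ v (hv : v ∈ T), f v = n → f v ≤ m →
      ∃ h : s ∈ T, (G.induce T).Reachable ⟨v, hv⟩ ⟨s, h⟩ := by
    intro n
    induction n using Nat.strong_induction_on with
    | _ n ih =>
    intro v hv hn hvm
    by_cases hvs : v = s
    · subst hvs; exact ⟨hv, Reachable.refl _⟩
    · obtain ⟨u, hvu, hlt⟩ := hlow v hvs
      have hu : u ∈ T := fun h => by have := hm u h; omega
      obtain ⟨h, hr⟩ := ih _ (hn ▸ hlt) u hu rfl (by omega)
      exact ⟨h, (Adj.reachable (induce_adj.mpr hvu)).trans hr⟩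
  have up : ∀ n, ∀ v (hv : v ∈ T), N - f v = n → m ≤ f v →
      ∃ h : t ∈ T, (G.induce T).Reachable ⟨v, hv⟩ ⟨t, h⟩ := by
    intro n
    induction n using Nat.strong_induction_on with
    | _ n ih =>
    intro v hv hn hvm
    by_cases hvt : v = t
    · subst hvt; exact ⟨hv, Reachable.refl _⟩
    · obtain ⟨u, hvu, hlt⟩ := hhigh v hvt
      have hu : u ∈ T := fun h => by have := hm u h; omega
      have := hN u
      obtain ⟨h, hr⟩ := ih (N - f u) (by omega) u hu rfl (by omega)
      exact ⟨h, (Adj.reachable (induce_adj.mpr hvu)).trans hr⟩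
  rintro ⟨x, hx⟩ ⟨y, hy⟩
  rcases le_total (f x) m with hxm | hxm <;> rcases le_total (f y) m with hym | hym
  · obtain ⟨_, h₁⟩ := down _ x hx rfl hxm
    obtain ⟨_, h₂⟩ := down _ y hy rfl hym
    exact h₁.trans h₂.symm
  · obtain ⟨_, h₁⟩ := down _ x hx rfl hxm
    obtain ⟨_, h₂⟩ := up _ y hy rfl hym
    exact (h₁.trans (Adj.reachable (induce_adj.mpr hst))).trans h₂.symm
  · obtain ⟨_, h₁⟩ := up _ x hx rfl hxm
    obtain ⟨_, h₂⟩ := down _ y hy rfl hym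
    exact (h₁.trans (Adj.reachable (induce_adj.mpr hst.symm))).trans h₂.symm
  · obtain ⟨_, h₁⟩ := up _ x hx rfl hxm
    obtain ⟨_, h₂⟩ := up _ y hy rfl hym
    exact h₁.trans h₂.symm

theorem Walk.support_subset_of_closed {u v : V} (p : G.Walk u v) {T : Set V} (hu : u ∈ T)
    (hT : ∀ z w, s(z, w) ∈ p.edges → z ∈ T → w ∈ T) : ∀ z ∈ p.support, z ∈ T := by
  induction p with
  | nil => simpa using hu
  | cons h p ih =>
    intro z hz
    rw [Walk.support_cons, List.mem_cons] at hz
    rcases hz with rfl | hz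
    · exact hu
    · exact ih (hT _ _ (by simp) hu) (fun z w h => hT z w (by simp [h])) z hz

theorem Walk.IsCycle.length_le_ncard {v : V} {c : G.Walk v v} (hc : c.IsCycle) {T : Set V}
    (hfin : T.Finite) (hT : ∀ z ∈ c.support, z ∈ T) : c.length ≤ T.ncard := by
  classical
  -- The tail drops the repeated base vertex.
  have h : c.support.tail.toFinset.card = c.length := by
    rw [List.toFinset_card_of_nodup hc.support_nodup]; simp
  rw [← h, ← Set.ncard_coe_finset]
  refine Set.ncard_le_ncard (fun z hz => hT z ?_) hfin
  exact List.mem_of_mem_tail (by simpa using hz)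

theorem ncard_pair_le_two (a b : V) : ({a, b} : Set V).ncard ≤ 2 :=
  (Set.ncard_insert_le _ _).trans (by simp)

/-- A cycle through a path `a x y b`, in which `x` and `y` have no further neighbours and `a` and `b`
are adjacent, is a four-cycle or has the chord `ab`. -/
theorem Walk.IsCycle.exists_isChord_or_length_le {v : V} {c : G.Walk v v} (hc : c.IsCycle)
    {x y a b : V} (hx : x ∈ c.support) (hxn : ∀ w ∈ c.support, G.Adj x w → w = y ∨ w = a)
    (hyn : ∀ w ∈ c.support, G.Adj y w → w = x ∨ w = b) (hab : G.Adj a b) :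
    (∃ e, c.IsChord e) ∨ c.length ≤ 4 := by
  classical
  let N := c.toSubgraph.neighborSet
  have hN : ∀ z w, w ∈ N z ↔ s(z, w) ∈ c.edges := fun z w => Walk.adj_toSubgraph_iff_mem_edges
  have hcomm : ∀ z w, w ∈ N z → z ∈ N w := fun z w h => c.toSubgraph.adj_symm h
  have hsupp : ∀ z w, w ∈ N z → w ∈ c.support := fun z w h =>
    Walk.snd_mem_support_of_mem_edges _ ((hN z w).mp h)
  have hadj : ∀ z w, w ∈ N z → G.Adj z w := fun z w h => c.toSubgraph.adj_sub h
  have htwo : ∀ z ∈ c.support, (N z).ncard = 2 := fun z h => hc.ncard_neighborSet_toSubgraph_eq_two h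
  have hfin : ∀ z ∈ c.support, (N z).Finite := fun z h =>
    Set.finite_of_ncard_ne_zero (by rw [htwo z h]; decide)
  have sub : ∀ z p q, z ∈ c.support → (∀ w ∈ N z, w = p ∨ w = q) → N z = {p, q} ∧ p ≠ q := by
    intro z p q hz h
    have h1 : N z = {p, q} := Set.eq_of_subset_of_ncard_le (fun w hw => h w hw)
      (by rw [htwo z hz]; exact ncard_pair_le_two p q) (Set.toFinite _)
    refine ⟨h1, fun hpq => ?_⟩
    have h2 := htwo z hz
    rw [h1, hpq] at h2
    simp at h2
  have sup : ∀ z p q, z ∈ c.support → p ∈ N z → q ∈ N z → p ≠ q → N z = {p, q} := by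
    intro z p q hz hp hq hpq
    refine (Set.eq_of_subset_of_ncard_le (Set.insert_subset hp (by simpa using hq)) ?_
      (hfin z hz)).symm
    rw [htwo z hz, Set.ncard_pair hpq]
  obtain ⟨hNx, hya⟩ := sub x y a hx fun w hw => hxn w (hsupp _ _ hw) (hadj _ _ hw)
  have hyx : y ∈ N x := by rw [hNx]; simp
  have hax : a ∈ N x := by rw [hNx]; simp
  have hy := hsupp _ _ hyx
  have ha := hsupp _ _ hax
  obtain ⟨hNy, hxb⟩ := sub y x b hy fun w hw => hyn w (hsupp _ _ hw) (hadj _ _ hw)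
  have hby : b ∈ N y := by rw [hNy]; simp
  have hb := hsupp _ _ hby
  by_cases he : s(a, b) ∈ c.edges
  swap
  · exact Or.inl ⟨_, Walk.isChord_sym2Mk.mpr ⟨hab, he, ha, hb⟩⟩
  right
  have hba : b ∈ N a := (hN _ _).mpr he
  have hNa := sup a x b ha (hcomm _ _ hax) hba hxb
  have hNb := sup b y a hb (hcomm _ _ hby) (hcomm _ _ hba) hya
  -- If `ab` lies on the cycle, the cycle neighbours of these four vertices are among them, so they
  -- exhaust the cycle.
  have hT : ∀ z ∈ (c.rotate x hx).support, z ∈ ({x, y, a, b} : Set V) := by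
    refine Walk.support_subset_of_closed _ (by simp) fun z w hzw hz => ?_
    have hw : w ∈ N z := (hN z w).mpr ((c.rotate_edges x hx).mem_iff.mp hzw)
    simp only [Set.mem_insert_iff, Set.mem_singleton_iff] at hz ⊢
    rcases hz with rfl | rfl | rfl | rfl
    · rw [hNx] at hw; simp only [Set.mem_insert_iff, Set.mem_singleton_iff] at hw; tauto
    · rw [hNy] at hw; simp only [Set.mem_insert_iff, Set.mem_singleton_iff] at hw; tauto
    · rw [hNa] at hw; simp only [Set.mem_insert_iff, Set.mem_singleton_iff] at hw; tauto
    · rw [hNb] at hw; simp only [Set.mem_insert_iff, Set.mem_singleton_iff] at hw; tauto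
  have h := ((Walk.isCycle_rotate hx).mpr hc).length_le_ncard (Set.toFinite _) hT
  rw [Walk.length_rotate] at h
  have h4 : ({x, y, a, b} : Set V).ncard ≤ 4 :=
    (Set.ncard_insert_le _ _).trans (Nat.succ_le_succ ((Set.ncard_insert_le _ _).trans
      (Nat.succ_le_succ (ncard_pair_le_two a b))))
  exact h.trans h4

/-- A bipartite graph built from at most five vertices by successively adding four-cycles along an
edge is chordal bipartite. Here `f` gives the step at which a vertex is added. -/
theorem isChordalBipartite_of_rank [Finite V] (hG : G.IsBipartite) (f : V → ℕ)
    (h0 : {w | f w = 0}.ncard ≤ 5)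
    (hf : ∀ x, f x ≠ 0 → ∃ y a b, G.Adj a b ∧
      (∀ w, f w ≤ f x → G.Adj x w → w = y ∨ w = a) ∧
      (∀ w, f w ≤ f x → G.Adj y w → w = x ∨ w = b)) : G.IsChordalBipartite := by
  refine ⟨hG, fun v c hc hlen => ?_⟩
  -- At a vertex of the cycle added last, all cycle vertices satisfy the rank condition in `hf`; if
  -- this rank is 0, the cycle has at most five vertices.
  obtain ⟨x, hx, hmax⟩ := Set.exists_max_image {z | z ∈ c.support} f (Set.toFinite _)
    ⟨v, c.start_mem_support⟩
  by_cases h : f x = 0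
  · have := hc.length_le_ncard (T := {w | f w = 0}) (Set.toFinite _) fun z hz =>
      Nat.le_zero.mp (h ▸ hmax z hz)
    omega
  · obtain ⟨y, a, b, hab, hxn, hyn⟩ := hf x h
    rcases hc.exists_isChord_or_length_le hx (fun w hw => hxn w (hmax w hw))
      (fun w hw => hyn w (hmax w hw)) hab with h | h
    · exact h
    · omega

theorem isBipartite_of_parity (f : V → ℕ) (hf : ∀ u v, G.Adj u v → f u % 2 ≠ f v % 2) :
    G.IsBipartite :=
  ⟨Coloring.mk (fun v => (⟨f v % 2, Nat.mod_lt _ (by decide)⟩ : Fin 2)) fun {u v} h heq =>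
    hf u v h (congrArg Fin.val heq)⟩

/-! ### The ladder -/

theorem gridGraph_two_adj {k : ℕ} {p q : Fin 2 × Fin k} : (gridGraph 2 k).Adj p q ↔
    (p.1 ≠ q.1 ∧ p.2 = q.2) ∨
      (p.1 = q.1 ∧ (p.2.val + 1 = q.2.val ∨ q.2.val + 1 = p.2.val)) := by
  obtain ⟨i, j⟩ := p
  obtain ⟨i', j'⟩ := q
  simp only [gridGraph, boxProd_adj, pathGraph_adj]
  constructor
  · rintro (⟨h, h'⟩ | ⟨h, h'⟩)
    · exact Or.inl ⟨fun h => by subst h; omega, h'⟩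
    · exact Or.inr ⟨h', h⟩
  · rintro (⟨h, h'⟩ | ⟨h, h'⟩)
    · exact Or.inl ⟨by omega, h'⟩
    · exact Or.inr ⟨h', h⟩

/-- Numbering of the ladder along its first path and back along the second one, `N` being the number
of the last vertex. -/
def ladderNumbering (N : ℕ) {k : ℕ} (p : Fin 2 × Fin k) : ℕ :=
  if p.1 = 0 then p.2.val else N - p.2.val

/-- Descend along the first path, or cross the rung from the second: `2k ≤ N` and `j < k` give `j <
N - j`. -/
theorem ladderNumbering_lower {N k : ℕ} (hN : 2 * k ≤ N) (hk : 0 < k) (p : Fin 2 × Fin k)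
    (hp : p ≠ (0, ⟨0, hk⟩)) : ∃ q, (gridGraph 2 k).Adj p q ∧
      ladderNumbering N q < ladderNumbering N p := by
  obtain ⟨i, j, hj⟩ := p
  fin_cases i
  · have : j ≠ 0 := by rintro rfl; exact hp rfl
    refine ⟨(0, ⟨j - 1, by omega⟩), gridGraph_two_adj.mpr (Or.inr ⟨rfl, Or.inr ?_⟩), ?_⟩
    · simp; omega
    · simp [ladderNumbering]; omega
  · refine ⟨(0, ⟨j, hj⟩), gridGraph_two_adj.mpr (Or.inl ⟨by simp, rfl⟩), ?_⟩
    simp [ladderNumbering]; omega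

theorem ladderNumbering_higher {N k : ℕ} (hN : 2 * k ≤ N) (hk : 0 < k) (p : Fin 2 × Fin k)
    (hp : p ≠ (1, ⟨0, hk⟩)) : ∃ q, (gridGraph 2 k).Adj p q ∧
      ladderNumbering N p < ladderNumbering N q := by
  obtain ⟨i, j, hj⟩ := p
  fin_cases i
  · refine ⟨(1, ⟨j, hj⟩), gridGraph_two_adj.mpr (Or.inl ⟨by simp, rfl⟩), ?_⟩
    simp [ladderNumbering]; omega
  · have : j ≠ 0 := by rintro rfl; exact hp rfl
    refine ⟨(1, ⟨j - 1, by omega⟩), gridGraph_two_adj.mpr (Or.inr ⟨rfl, Or.inr ?_⟩), ?_⟩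
    · simp; omega
    · simp [ladderNumbering]; omega

theorem gridGraph_two_parity {k : ℕ} {p q : Fin 2 × Fin k} (h : (gridGraph 2 k).Adj p q) :
    (p.1.val + p.2.val) % 2 ≠ (q.1.val + q.2.val) % 2 := by
  rcases gridGraph_two_adj.mp h with ⟨h, h'⟩ | ⟨h, h'⟩
  · rw [h']; omega
  · rw [h]; omega

/-- The neighbours in the earlier columns of the vertices of a column. -/
theorem gridGraph_two_last_column {k : ℕ} (x : Fin 2 × Fin k) (hx : x.2.val ≠ 0) :
    ∃ y a b : Fin 2 × Fin k, y.2 = x.2 ∧ (gridGraph 2 k).Adj a b ∧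
      (∀ w : Fin 2 × Fin k, w.2 ≤ x.2 → (gridGraph 2 k).Adj x w → w = y ∨ w = a) ∧
      (∀ w : Fin 2 × Fin k, w.2 ≤ x.2 → (gridGraph 2 k).Adj y w → w = x ∨ w = b) := by
  obtain ⟨i, j, hj⟩ := x
  simp only at hx
  refine ⟨(1 - i, ⟨j, hj⟩), (i, ⟨j - 1, by omega⟩), (1 - i, ⟨j - 1, by omega⟩), rfl,
    gridGraph_two_adj.mpr (Or.inl ⟨?_, rfl⟩), ?_, ?_⟩
  · fin_cases i <;> simp
  all_goals
    rintro ⟨i', j', hj'⟩ hle h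
    have hle' : j' ≤ j := hle
    simp only [gridGraph_two_adj, Fin.mk.injEq] at h
    simp only [Prod.mk.injEq, Fin.mk.injEq]
    omega

/-- There are `k` rungs and `k - 1` edges on each path. The upper bound needs only that `g` covers
all edges. -/
theorem ncard_edgeSet_gridGraph_two_le (k : ℕ) : (gridGraph 2 k).edgeSet.ncard ≤ k + 2 * (k - 1) := by
  let g : Fin k ⊕ (Fin 2 × Fin (k - 1)) → Sym2 (Fin 2 × Fin k)
    | .inl j => s((0, j), (1, j))
    | .inr (i, j) => s((i, ⟨j, by omega⟩), (i, ⟨j + 1, by omega⟩))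
  have hsub : (gridGraph 2 k).edgeSet ⊆ Set.range g := by
    intro e he
    induction e with
    | _ p q =>
    obtain ⟨i, j, hj⟩ := p
    obtain ⟨i', j', hj'⟩ := q
    rcases gridGraph_two_adj.mp he with ⟨h, h'⟩ | ⟨h, h' | h'⟩ <;> simp only at h h'
    · obtain rfl : j = j' := congrArg Fin.val h'
      refine ⟨.inl ⟨j, hj⟩, ?_⟩
      fin_cases i <;> fin_cases i'
      · exact absurd rfl h
      · rfl
      · exact Sym2.eq_swap
      · exact absurd rfl h
    · subst h h'
      exact ⟨.inr (i, ⟨j, by omega⟩), rfl⟩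
    · subst h h'
      exact ⟨.inr (i, ⟨j', by omega⟩), Sym2.eq_swap⟩
  refine (Set.ncard_le_ncard hsub (Set.toFinite _)).trans ?_
  rw [← Set.image_univ]
  refine (Set.ncard_image_le (Set.toFinite _)).trans ?_
  rw [Set.ncard_univ]
  simp

theorem gridGraph_two_isVertexKConnected {k : ℕ} (hk : 2 ≤ k) :
    (gridGraph 2 k).IsVertexKConnected 2 :=
  isVertexKConnected_two_of_numbering (by simp; omega) (ladderNumbering (2 * k))
    (gridGraph_two_adj_first_rung k (by omega)) (ladderNumbering_lower le_rfl _)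
    (ladderNumbering_higher le_rfl _)

theorem gridGraph_two_isChordalBipartite (k : ℕ) : (gridGraph 2 k).IsChordalBipartite := by
  refine isChordalBipartite_of_rank (isBipartite_of_parity _ fun _ _ => gridGraph_two_parity)
    (fun p => p.2.val) ?_ fun x hx => ?_
  · have : Set.InjOn Prod.fst {w : Fin 2 × Fin k | w.2.val = 0} := by
      rintro ⟨i, j⟩ h ⟨i', j'⟩ h' heq
      exact Prod.ext heq (Fin.ext (Eq.trans h (Eq.symm h')))
    rw [← this.ncard_image]
    refine (Set.ncard_le_ncard (Set.subset_univ _) (Set.toFinite _)).trans ?_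
    rw [Set.ncard_univ]
    simp
  · obtain ⟨y, a, b, hy, hab, h, h'⟩ := gridGraph_two_last_column x hx
    exact ⟨y, a, b, hab, fun w hw => h w hw, fun w hw => h' w hw⟩

/-! ### The ladder glued to `K_{2,3}` -/

variable {k : ℕ} {hk : 0 < k}

/-- The vertices of `K_{2,3}` not on the edge along which it is glued. -/
abbrev K23Rest : Type := {w : Fin 2 ⊕ Fin 3 // w ≠ Sum.inl 0 ∧ w ≠ Sum.inr 0}

namespace K23Rest

/-- The second vertex of the first side of `K_{2,3}`. -/
def hub : K23Rest := ⟨.inl 1, by simp⟩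

/-- The second vertex of the second side of `K_{2,3}`. -/
def left : K23Rest := ⟨.inr 1, by simp⟩

/-- The third vertex of the second side of `K_{2,3}`. -/
def right : K23Rest := ⟨.inr 2, by simp⟩

theorem eq_or (w : K23Rest) : w = hub ∨ w = left ∨ w = right := by
  obtain ⟨w, hw⟩ := w
  revert w
  simp only [hub, left, right, Subtype.mk.injEq]
  decide

theorem card_eq : Nat.card K23Rest = 3 := by
  rw [Nat.card_eq_fintype_card]; rfl

/-- Numbers of the vertices of `K_{2,3}` off the glued edge. -/
def numbering (w : K23Rest) : ℕ := if w = hub then 2 else 1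

end K23Rest

open K23Rest

theorem ladderGlueK23_adj_inl {p q : Fin 2 × Fin k} :
    (ladderGlueK23 k hk).Adj (.inl p) (.inl q) ↔ (gridGraph 2 k).Adj p q := Iff.rfl

theorem ladderGlueK23_adj_inr {v w : K23Rest} :
    (ladderGlueK23 k hk).Adj (.inr v) (.inr w) ↔ (v = hub ↔ w ≠ hub) := by
  change (completeBipartiteGraph (Fin 2) (Fin 3)).Adj v.1 w.1 ↔ _
  rcases v.eq_or with rfl | rfl | rfl <;> rcases w.eq_or with rfl | rfl | rfl <;>
    simp [hub, left, right]

/-- The rung vertex `(0,0)` plays `inl 0`, adjacent to `left` and `right`; `(1,0)` plays `inr 0`,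
adjacent to `hub`. -/
theorem ladderGlueK23_adj_inl_inr {p : Fin 2 × Fin k} {w : K23Rest} :
    (ladderGlueK23 k hk).Adj (.inl p) (.inr w) ↔
      p.2.val = 0 ∧ (p.1 = 1 ↔ w = hub) := by
  change (p = _ ∧ (completeBipartiteGraph (Fin 2) (Fin 3)).Adj _ w.1) ∨
    (p = _ ∧ (completeBipartiteGraph (Fin 2) (Fin 3)).Adj _ w.1) ↔ _
  obtain ⟨i, j, hj⟩ := p
  rcases w.eq_or with rfl | rfl | rfl <;> fin_cases i <;> simp [hub, left, right]

/-- Parity classes of the vertices of the glued graph. -/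
theorem ladderGlueK23_isBipartite : (ladderGlueK23 k hk).IsBipartite := by
  let f : (Fin 2 × Fin k) ⊕ K23Rest → ℕ := Sum.elim (fun p => p.1.val + p.2.val) numbering
  have hmix : ∀ p w, (ladderGlueK23 k hk).Adj (.inl p) (.inr w) →
      (p.1.val + p.2.val) % 2 ≠ numbering w % 2 := by
    intro p w h
    obtain ⟨h0, h1⟩ := ladderGlueK23_adj_inl_inr.mp h
    rw [h0, numbering]
    split_ifs with hw
    · rw [h1.mpr hw]; decide
    · have : p.1 ≠ 1 := fun h => hw (h1.mp h)
      omega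
  refine isBipartite_of_parity f ?_
  rintro (p | v) (q | w) h
  · exact gridGraph_two_parity h
  · exact hmix p w h
  · exact (hmix q v h.symm).symm
  · have := ladderGlueK23_adj_inr.mp h
    simp only [f, Sum.elim_inr, numbering]
    split_ifs <;> simp_all

theorem ladderGlueK23_isVertexKConnected :
    (ladderGlueK23 k hk).IsVertexKConnected 2 := by
  -- The numbers 1 and 2 must lie strictly between those of the rung ends, 0 and `N`; for `k = 1`
  -- the choice `N = 2k` would fail.
  let f : (Fin 2 × Fin k) ⊕ K23Rest → ℕ := Sum.elim (ladderNumbering (2 * k + 3)) numbering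
  have hs : (ladderGlueK23 k hk).Adj (.inl (0, ⟨0, hk⟩)) (.inl (1, ⟨0, hk⟩)) :=
    gridGraph_two_adj_first_rung k hk
  refine isVertexKConnected_two_of_numbering (by rw [Nat.card_sum, card_eq]; omega) f hs ?_ ?_
  · rintro (p | w) hp
    · obtain ⟨q, hq, hlt⟩ := ladderNumbering_lower (N := 2 * k + 3) (by omega) hk p
        (fun h => hp (congrArg _ h))
      exact ⟨.inl q, hq, hlt⟩
    · by_cases hw : w = hub
      · refine ⟨.inr left, ladderGlueK23_adj_inr.mpr ?_, ?_⟩ <;>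
          simp [f, numbering, hw, left, hub]
      · refine ⟨.inl (0, ⟨0, hk⟩), (ladderGlueK23_adj_inl_inr.mpr ?_).symm, ?_⟩ <;>
          simp [f, numbering, ladderNumbering, hw]
  · rintro (p | w) hp
    · obtain ⟨q, hq, hlt⟩ := ladderNumbering_higher (N := 2 * k + 3) (by omega) hk p
        (fun h => hp (congrArg _ h))
      exact ⟨.inl q, hq, hlt⟩
    · by_cases hw : w = hub
      · refine ⟨.inl (1, ⟨0, hk⟩), (ladderGlueK23_adj_inl_inr.mpr ?_).symm, ?_⟩ <;>
          simp [f, numbering, ladderNumbering, hw]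
      · refine ⟨.inr hub, ladderGlueK23_adj_inr.mpr ?_, ?_⟩ <;>
          simp [f, numbering, hw]

theorem ladderGlueK23_isChordalBipartite : (ladderGlueK23 k hk).IsChordalBipartite := by
  -- Rank 0 consists of the five vertices of `K_{2,3}`; each later column closes a four-cycle.
  let f : (Fin 2 × Fin k) ⊕ K23Rest → ℕ := Sum.elim (fun p => p.2.val) (fun _ => 0)
  refine isChordalBipartite_of_rank ladderGlueK23_isBipartite f ?_ ?_
  · let g : (Fin 2 × Fin k) ⊕ K23Rest → Fin 2 ⊕ K23Rest := Sum.map Prod.fst id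
    have : Set.InjOn g {w | f w = 0} := by
      rintro (⟨i, j⟩ | v) h (⟨i', j'⟩ | w) h' heq
      · exact congrArg Sum.inl
          (Prod.ext (Sum.inl_injective heq) (Fin.ext (Eq.trans h (Eq.symm h'))))
      · simp [g] at heq
      · simp [g] at heq
      · exact congrArg Sum.inr (Sum.inr_injective heq)
    rw [← this.ncard_image]
    refine (Set.ncard_le_ncard (Set.subset_univ _) (Set.toFinite _)).trans ?_
    rw [Set.ncard_univ, Nat.card_sum, card_eq]
    simp
  · rintro (x | w) hx
    · obtain ⟨y, a, b, hy, hab, h, h'⟩ := gridGraph_two_last_column x hx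
      have hx : x.2.val ≠ 0 := hx
      refine ⟨.inl y, .inl a, .inl b, hab, ?_, ?_⟩
      · rintro (w | w) hw hadj
        · exact (h w hw hadj).imp (congrArg _) (congrArg _)
        · exact absurd (ladderGlueK23_adj_inl_inr.mp hadj).1 hx
      · rintro (w | w) hw hadj
        · exact (h' w hw hadj).imp (congrArg _) (congrArg _)
        · exact absurd (ladderGlueK23_adj_inl_inr.mp hadj).1 (hy ▸ hx)
    · exact absurd rfl hx

theorem ncard_edgeSet_ladderGlueK23_le :
    (ladderGlueK23 k hk).edgeSet.ncard ≤ k + 2 * (k - 1) + 5 := by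
  classical
  let s : (Fin 2 × Fin k) ⊕ K23Rest := .inl (0, ⟨0, hk⟩)
  let t : (Fin 2 × Fin k) ⊕ K23Rest := .inl (1, ⟨0, hk⟩)
  -- The edges of `K_{2,3}` other than the glued one.
  let E : Finset (Sym2 ((Fin 2 × Fin k) ⊕ K23Rest)) :=
    {s(s, .inr left), s(s, .inr right), s(t, .inr hub), s(.inr hub, .inr left),
      s(.inr hub, .inr right)}
  have hmix : ∀ p w, (ladderGlueK23 k hk).Adj (.inl p) (.inr w) → s(.inl p, .inr w) ∈ E := by
    rintro ⟨i, j, hj⟩ w h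
    obtain ⟨h0, h1⟩ := ladderGlueK23_adj_inl_inr.mp h
    obtain rfl : j = 0 := h0
    rcases K23Rest.eq_or w with rfl | rfl | rfl <;> fin_cases i <;>
      simp [hub, left, right] at h1 <;> simp [E, s, t]
  have hsub : (ladderGlueK23 k hk).edgeSet ⊆
      Sym2.map Sum.inl '' (gridGraph 2 k).edgeSet ∪ (E : Set _) := by
    intro e he
    induction e with
    | _ p q =>
    rw [mem_edgeSet] at he
    rcases p with p | v <;> rcases q with q | w
    · exact Or.inl ⟨s(p, q), he, rfl⟩
    · exact Or.inr (hmix p w he)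
    · exact Or.inr (Sym2.eq_swap ▸ hmix q v he.symm)
    · right
      have h := ladderGlueK23_adj_inr.mp he
      rcases K23Rest.eq_or v with rfl | rfl | rfl <;> rcases K23Rest.eq_or w with rfl | rfl | rfl <;>
        simp [hub, left, right] at h <;> simp [E, s, t]
  refine (Set.ncard_le_ncard hsub (Set.toFinite _)).trans ((Set.ncard_union_le _ _).trans ?_)
  refine Nat.add_le_add ((Set.ncard_image_le (Set.toFinite _)).trans
    (ncard_edgeSet_gridGraph_two_le k)) ?_
  rw [Set.ncard_coe_finset]
  exact Finset.card_le_five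

end SimpleGraph

/-! ### The theorem -/

theorem theorem1p1 (n : ℕ) (hn : 4 ≤ n) :
    -- the lower bounds
    (∀ (V : Type*) [Finite V] (G : SimpleGraph V), Nat.card V = n →
      G.IsVertexKConnected 2 → G.IsChordalBipartite →
        (Odd n → (3 * (n : ℚ) - 3) / 2 ≤ (G.edgeSet.ncard : ℚ)) ∧
        (Even n → 3 * (n : ℚ) / 2 - 2 ≤ (G.edgeSet.ncard : ℚ))) ∧
    -- both bounds are tight for every order
    (Odd n → ∃ G : SimpleGraph (Fin n), G.IsVertexKConnected 2 ∧ G.IsChordalBipartite ∧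
      (G.edgeSet.ncard : ℚ) = (3 * (n : ℚ) - 3) / 2) ∧
    (Even n → ∃ G : SimpleGraph (Fin n), G.IsVertexKConnected 2 ∧ G.IsChordalBipartite ∧
      (G.edgeSet.ncard : ℚ) = 3 * (n : ℚ) / 2 - 2) ∧
    -- the ladder attains the bound for even order
    (∀ k : ℕ, n = 2 * k →
      Nat.card (Fin 2 × Fin k) = n ∧
      (SimpleGraph.gridGraph 2 k).IsVertexKConnected 2 ∧
      (SimpleGraph.gridGraph 2 k).IsChordalBipartite ∧
      ((SimpleGraph.gridGraph 2 k).edgeSet.ncard : ℚ) = 3 * (n : ℚ) / 2 - 2) ∧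
    -- the ladder glued to `K_{2,3}` along an edge attains the bound for odd order
    (∀ (k : ℕ) (hk : 0 < k), n = 2 * k + 3 →
      Nat.card ((Fin 2 × Fin k) ⊕
        {w : Fin 2 ⊕ Fin 3 // w ≠ Sum.inl 0 ∧ w ≠ Sum.inr 0}) = n ∧
      (SimpleGraph.ladderGlueK23 k hk).IsVertexKConnected 2 ∧
      (SimpleGraph.ladderGlueK23 k hk).IsChordalBipartite ∧
      ((SimpleGraph.ladderGlueK23 k hk).edgeSet.ncard : ℚ) = (3 * (n : ℚ) - 3) / 2) := by
  have ladder : ∀ k : ℕ, n = 2 * k →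
      Nat.card (Fin 2 × Fin k) = n ∧
      (SimpleGraph.gridGraph 2 k).IsVertexKConnected 2 ∧
      (SimpleGraph.gridGraph 2 k).IsChordalBipartite ∧
      ((SimpleGraph.gridGraph 2 k).edgeSet.ncard : ℚ) = 3 * (n : ℚ) / 2 - 2 := by
    intro k hk
    have hcard : Nat.card (Fin 2 × Fin k) = n := by simp [hk]
    have h2 := SimpleGraph.gridGraph_two_isVertexKConnected (k := k) (by omega)
    have hc := SimpleGraph.gridGraph_two_isChordalBipartite k
    refine ⟨hcard, h2, hc, ?_⟩
    have hle := SimpleGraph.ncard_edgeSet_gridGraph_two_le k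
    have hge := hc.three_mul_card_le h2 (by omega)
    have heq : (SimpleGraph.gridGraph 2 k).edgeSet.ncard + 2 = 3 * k := by omega
    have heq' : ((SimpleGraph.gridGraph 2 k).edgeSet.ncard : ℚ) + 2 = 3 * k := by
      exact_mod_cast heq
    rw [hk]; push_cast; linarith
  have glued : ∀ (k : ℕ) (hk : 0 < k), n = 2 * k + 3 →
      Nat.card ((Fin 2 × Fin k) ⊕
        {w : Fin 2 ⊕ Fin 3 // w ≠ Sum.inl 0 ∧ w ≠ Sum.inr 0}) = n ∧
      (SimpleGraph.ladderGlueK23 k hk).IsVertexKConnected 2 ∧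
      (SimpleGraph.ladderGlueK23 k hk).IsChordalBipartite ∧
      ((SimpleGraph.ladderGlueK23 k hk).edgeSet.ncard : ℚ) = (3 * (n : ℚ) - 3) / 2 := by
    intro k hk hn'
    have hcard : Nat.card ((Fin 2 × Fin k) ⊕ SimpleGraph.K23Rest) = n := by
      rw [Nat.card_sum, SimpleGraph.K23Rest.card_eq]; simp [hn']
    have h2 := SimpleGraph.ladderGlueK23_isVertexKConnected (hk := hk)
    have hc := SimpleGraph.ladderGlueK23_isChordalBipartite (hk := hk)
    refine ⟨hcard, h2, hc, ?_⟩
    have hle := SimpleGraph.ncard_edgeSet_ladderGlueK23_le (hk := hk)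
    have hge : 3 * n ≤ 2 * (SimpleGraph.ladderGlueK23 k hk).edgeSet.ncard + 4 :=
      (congrArg (3 * ·) hcard).symm.le.trans
        (hc.three_mul_card_le h2 (le_of_le_of_eq (by omega : 2 ≤ n) hcard.symm))
    -- Here `hge` reads `6k + 5 ≤ 2m`, which integrality rounds up to `3k + 3 ≤ m`.
    have heq : (SimpleGraph.ladderGlueK23 k hk).edgeSet.ncard = 3 * k + 3 := by omega
    rw [heq, hn']; push_cast; ring
  refine ⟨fun V _ G hV h2 hc => ?_, fun hodd => ?_, fun heven => ?_, ladder, glued⟩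
  · have h := hc.three_mul_card_le h2 (by omega)
    rw [hV] at h
    refine ⟨fun hodd => ?_, fun _ => ?_⟩
    · obtain ⟨r, hr⟩ := hodd
      -- For odd `n` the two sides of `h` have different parity, which gains one.
      have h' : 3 * n ≤ 2 * G.edgeSet.ncard + 3 := by omega
      have h'' : 3 * (n : ℚ) ≤ 2 * (G.edgeSet.ncard : ℚ) + 3 := by exact_mod_cast h'
      linarith
    · have h'' : 3 * (n : ℚ) ≤ 2 * (G.edgeSet.ncard : ℚ) + 4 := by exact_mod_cast h
      linarith
  · obtain ⟨r, hr⟩ := hodd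
    obtain ⟨hcard, h2, hc, hm⟩ := glued (r - 1) (by omega) (by omega)
    let e := SimpleGraph.Iso.map (Finite.equivFinOfCardEq hcard)
      (SimpleGraph.ladderGlueK23 (r - 1) (by omega))
    exact ⟨_, h2.of_iso e (by omega), hc.of_iso e, by
      rw [← SimpleGraph.ncard_edgeSet_congr e, hm]⟩
  · obtain ⟨r, hr⟩ := heven
    obtain ⟨hcard, h2, hc, hm⟩ := ladder r (by omega)
    let e := SimpleGraph.Iso.map (Finite.equivFinOfCardEq hcard) (SimpleGraph.gridGraph 2 r)
    exact ⟨_, h2.of_iso e (by omega), hc.of_iso e, by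
      rw [← SimpleGraph.ncard_edgeSet_congr e, hm]⟩
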